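/- **Setting.** Let $L\subset S^3=\mathbb R^3\cup\{\infty\}$ be a link, $k\ge 0$, and $R$ a commutative ring. All surfaces are compact and tame (locally flat), possibly disconnected or non-orientable. *Local models* (coordinates $(x,y,z)$ in $\mathbb R^3$). For $w>0$ let $X_w=\{|x|\le w,\ |z|\le 1,\ y=xz\}$ and $Y_w=\{|y|\le w,\ |z|\le 1,\ x=yz\}$; these are bands between the two skew lines $(t,t,1)$ and $(t,-t,-1)$, turning in the left-handed and in the right-handed sense respectively. The model crosscut is the segment $\{(0,0,z):|z|\le 1\}$, directed upwards. An *active* crosscut has the model neighbourhood $\{|x|,|y|\le 1,\ |z|\le 5\}$ with the band $X_1$ and we put $r=\tfrac12$; an *inactive* one has the model neighbourhood $\{|x|,|y|\le \tfrac18,\ |z|\le 2\}$ with the band $Y_{1/8}$ and $r=\tfrac1{16}$. *Surfaces with crosscuts.* A surface $F$ with $k$ crosscuts and $\partial F=L$ carries $k$ ordered, directed, properly embedded arcs $c_1,\dots,c_k$, each labelled active or inactive, and finitely many dots on $F\setminus L$ off the crosscut neighbourhoods. The crosscuts have pairwise disjoint standard neighbourhoods: orientation-preserving tame embeddings of the model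 neighbourhood in $S^3$ in which $F$ is the model band and the crosscut is the model crosscut. Such surfaces are considered up to ambient isotopy of $S^3$ that maps $L$ onto itself at all times and carries surface, crosscuts (with order, directions, labels), dots and standard neighbourhoods to each other, where a standard neighbourhood may also be carried to the other one composed with the half-turn $(x,y,z)\mapsto(-x,-y,z)$. *$D^k$-surfaces.* The cross-dual $F^{cd}$ is obtained by cutting $F$ at each crosscut and inserting a right-handed (active) or left-handed (inactive) half-twisted strip; in the model, the part of the band with $|x|<r$ (active) or $|y|<r$ (inactive) is replaced by the untwisted strip $\{|x|,|y|\le r,\ z=xy/r^2\}$, locally oriented so as to be counterclockwise as seen from above. Its skeleton is $\partial F^{cd}$ together with these strips. $F$ is a *$D^k$-surface* if $F^{cd}$ is orientable and $S^3$ is the union of two tame closed balls $B_+,B_-$ meeting in their common boundary sphere $\Sigma$, oriented as seen from $B_-$, such that the skeleton lies in $\Sigma$, the local orientations of the strips agree with the orientation of $\Sigma$, and the rest of $F^{cd}$ lies in $B_+$. Let $\mathcal C_k(L)$ be the free $R$-module on the isotopy classes of $D^k$-surfaces with boundary $L$, a submodule of the free $R$-module $\mathcal A_k(L)$ on the isotopy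 classes of all subsets of $S^3$ with the same decorations ($k$ crosscuts with standard neighbourhoods, and dots). ($\mathcal C_k(L)$ is the direct sum of the chain modules $\mathcal C_{i,j,k,b}(L)$ over all values $i,j,b$ of the other three gradings of the generators.) *Local maps and differential.* For an active crosscut $c$ of $F$, the local map $d_c$ replaces the band $X_1$ in the standard neighbourhood of $c$ by $$\{p\in X_1: |x|\ge \tfrac12\}\ \cup\ \{|x|,|y|\le\tfrac12,\ z=4xy-8(\tfrac12-\max(|x|,|y|))\}\ \cup\ Y_{1/2},$$ that is, by a saddle with a second half-twisted band, of the opposite handedness, attached in front of it; the same directed arc, on the new band, becomes an inactive crosscut, and nothing else changes. Write $d_i$ for the linear map on $\mathcal A_k(L)$ with $d_i(F)=d_{c_i}(F)$ if $c_i$ is active and $d_i(F)=0$ otherwise. The differential is the linear map $$d(F)=\sum_{c\ \text{active crosscut of }F}(-1)^{\alpha(c)}\,d_c(F),$$ where $\alpha(c)$ is the number of inactive crosscuts of $F$ that come before $c$. **Theorem.** On $\mathcal C_k(L)$ the local maps at distinct crosscuts commute, $d_i\circ d_j=d_j\circ d_i$ for $i\ne j$, and $d\circ d=0$. -/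

import Mathlib

noncomputable section

open Topology Filter

namespace Diagramless

/-- Oriented Euclidean 3-space, with coordinates `(x, y, z) = (p.1, p.2.1, p.2.2)`. -/
abbrev R3 : Type := ℝ × ℝ × ℝ

/-- The 3-sphere, as the one-point compactification of 3-space. -/
abbrev S3 : Type := OnePoint R3

/-! ### Ambient isotopy -/

/-- `h` is the end of an ambient isotopy of the 3-sphere that maps `L` onto itself at all times. -/
def IsotopicToId (L : Set S3) (h : S3 ≃ₜ S3) : Prop :=
  ∃ H : unitInterval → (S3 ≃ₜ S3), Continuous (fun q : unitInterval × S3 => H q.1 q.2) ∧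
    H 0 = Homeomorph.refl S3 ∧ H 1 = h ∧ ∀ t, H t '' L = L

theorem IsotopicToId.refl (L : Set S3) : IsotopicToId L (Homeomorph.refl S3) :=
  ⟨fun _ => Homeomorph.refl S3, continuous_snd, rfl, rfl, fun _ => by simp⟩

theorem IsotopicToId.symm {L : Set S3} {h : S3 ≃ₜ S3} (hh : IsotopicToId L h) :
    IsotopicToId L h.symm := by
  obtain ⟨H, hc, h0, h1, hL⟩ := hh
  have hsL : h.symm '' L = L := by
    have e := hL 1
    rw [h1] at e
    conv_lhs => rw [← e]
    rw [← Set.image_comp]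
    simp
  refine ⟨fun t => h.symm.trans (H (unitInterval.symm t)), ?_, ?_, ?_, ?_⟩
  · exact hc.comp ((unitInterval.continuous_symm.comp continuous_fst).prodMk
      (h.symm.continuous.comp continuous_snd))
  · ext x; simp [h1]
  · ext x; simp [h0]
  · intro t
    change (fun x => H (unitInterval.symm t) (h.symm x)) '' L = L
    rw [← Set.image_image (H (unitInterval.symm t)) h.symm L, hsL, hL]

theorem IsotopicToId.trans {L : Set S3} {h h' : S3 ≃ₜ S3} (hh : IsotopicToId L h)
    (hh' : IsotopicToId L h') : IsotopicToId L (h.trans h') := by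
  obtain ⟨H, hc, h0, h1, hL⟩ := hh
  obtain ⟨K, kc, k0, k1, kL⟩ := hh'
  refine ⟨fun t => (H t).trans (K t), ?_, ?_, ?_, ?_⟩
  · exact kc.comp (continuous_fst.prodMk hc)
  · ext x; simp [h0, k0]
  · ext x; simp [h1, k1]
  · intro t
    change (fun x => K t (H t x)) '' L = L
    rw [← Set.image_image (K t) (H t) L, hL, kL]

/-! ### Locally flat surfaces in the 3-sphere -/

/-- Near `p`, the set `X` looks like a plane in 3-space. -/
def IsInteriorPoint (X : Set S3) (p : S3) : Prop :=
  ∃ e : OpenPartialHomeomorph S3 R3, p ∈ e.source ∧ (e p).2.2 = 0 ∧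
    ∀ q ∈ e.source, q ∈ X ↔ (e q).2.2 = 0

/-- Near `p`, the set `X` looks like a closed half-plane in 3-space, with `p` on its edge. -/
def IsBoundaryPoint (X : Set S3) (p : S3) : Prop :=
  ∃ e : OpenPartialHomeomorph S3 R3, p ∈ e.source ∧ (e p).2.2 = 0 ∧ (e p).2.1 = 0 ∧
    ∀ q ∈ e.source, q ∈ X ↔ (e q).2.2 = 0 ∧ 0 ≤ (e q).2.1

/-- The boundary of a surface. -/
def surfaceBoundary (X : Set S3) : Set S3 := {p | IsBoundaryPoint X p}

/-- Compact (tame, possibly disconnected or non-orientable) surfaces in the 3-sphere. -/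
def IsCompactSurface (X : Set S3) : Prop :=
  IsCompact X ∧ ∀ p ∈ X, IsInteriorPoint X p ∨ IsBoundaryPoint X p

/-- Orientability of a surface in the 3-sphere.  As the 3-sphere is orientable, this is
two-sidedness: the two sides of the surface can be told apart consistently by two disjoint
open sets. -/
def IsOrientableSurface (X : Set S3) : Prop :=
  ∃ U V : Set S3, IsOpen U ∧ IsOpen V ∧ Disjoint U V ∧
    ∀ p ∈ X, IsInteriorPoint X p →
      ∃ e : OpenPartialHomeomorph S3 R3, p ∈ e.source ∧ (e p).2.2 = 0 ∧
        ∀ q ∈ e.source, (q ∈ X ↔ (e q).2.2 = 0) ∧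
          (0 < (e q).2.2 → q ∈ U) ∧ ((e q).2.2 < 0 → q ∈ V)

/-! ### The local models

In the model the link consists of the two skew segments `(t, t, 1)` and `(t, -t, -1)`, seen from
the positive `z`-direction as a crossing, and the crosscut is the segment `(0, 0, z)`,
`-1 ≤ z ≤ 1`, directed upwards.  The label is `true` for active and `false` for inactive
crosscuts. -/

/-- Half the width of the model neighbourhood of a crosscut. -/
def boxWidth (a : Bool) : ℝ := if a then 1 else 1 / 8

/-- Half the height of the model neighbourhood of a crosscut. -/
def boxHeight (a : Bool) : ℝ := if a then 5 else 2

/-- The model neighbourhood of a crosscut: a ball in 3-space. -/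
def box (a : Bool) : Set R3 :=
  {p | |p.1| ≤ boxWidth a ∧ |p.2.1| ≤ boxWidth a ∧ |p.2.2| ≤ boxHeight a}

/-- The band that joins the two skew lines by segments in the planes `x = const`;
it turns in the left-handed sense. -/
def bandX (w : ℝ) : Set R3 := {p | |p.1| ≤ w ∧ |p.2.2| ≤ 1 ∧ p.2.1 = p.1 * p.2.2}

/-- The band that joins the two skew lines by segments in the planes `y = const`;
it turns in the right-handed sense. -/
def bandY (w : ℝ) : Set R3 := {p | |p.2.1| ≤ w ∧ |p.2.2| ≤ 1 ∧ p.1 = p.2.1 * p.2.2}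

/-- The part of the surface in the model neighbourhood of a crosscut. -/
def band (a : Bool) : Set R3 := if a then bandX (boxWidth a) else bandY (boxWidth a)

/-- The saddle below the crosscut, bounded by two segments of `bandX` in the planes `x = ±1/2`
and two segments of `bandY` in the planes `y = ±1/2`. -/
def saddle : Set R3 :=
  {p | |p.1| ≤ 1 / 2 ∧ |p.2.1| ≤ 1 / 2 ∧
    p.2.2 = 4 * p.1 * p.2.1 - 8 * (1 / 2 - max |p.1| |p.2.1|)}

/-- The piece of surface that replaces the band around an active crosscut: the ends of that band,
joined by the saddle, and in front of the saddle a second band, of the opposite handedness,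
on which the same arc is the new crosscut. -/
def replacement : Set R3 :=
  {p | p ∈ bandX 1 ∧ 1 / 2 ≤ |p.1|} ∪ saddle ∪ bandY (1 / 2)

/-- The half-turn about the axis of the crosscut.  It exchanges the two sides of the band. -/
def halfTurn (p : R3) : R3 := (-p.1, -p.2.1, p.2.2)

/-- The image in the 3-sphere of a subset of the model. -/
def place (h : S3 ≃ₜ S3) (A : Set R3) : Set S3 := (fun p : R3 => h (p : S3)) '' A

theorem halfTurn_halfTurn (p : R3) : halfTurn (halfTurn p) = p := by
  simp [halfTurn]

theorem halfTurn_mem_box {a : Bool} {p : R3} (hp : p ∈ box a) : halfTurn p ∈ box a := by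
  simpa [box, halfTurn] using hp

theorem halfTurn_mem_replacement {p : R3} (hp : p ∈ replacement) :
    halfTurn p ∈ replacement := by
  rcases hp with (⟨⟨h1, h2, h3⟩, h4⟩ | ⟨h1, h2, h3⟩) | ⟨h1, h2, h3⟩
  · exact Or.inl (Or.inl ⟨⟨by simpa [halfTurn] using h1, h2, by simp [halfTurn, h3]⟩,
      by simpa [halfTurn] using h4⟩)
  · refine Or.inl (Or.inr ⟨by simpa [halfTurn] using h1, by simpa [halfTurn] using h2, ?_⟩)
    simp only [halfTurn, abs_neg, h3]
    ring
  · exact Or.inr ⟨by simpa [halfTurn] using h1, h2, by simp [halfTurn, h3]⟩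

theorem box_false_subset : box false ⊆ box true := by
  rintro p ⟨h1, h2, h3⟩
  simp only [boxWidth, boxHeight, Bool.false_eq_true, if_false] at h1 h2 h3
  refine ⟨?_, ?_, ?_⟩ <;> simp only [boxWidth, boxHeight, if_true] <;> linarith

theorem box_subset (a : Bool) : box a ⊆ box true := by
  cases a
  · exact box_false_subset
  · exact subset_rfl

theorem replacement_subset : replacement ⊆ box true := by
  rintro p ((⟨⟨h1, h2, h3⟩, -⟩ | ⟨h1, h2, h3⟩) | ⟨h1, h2, h3⟩)
  · have hy : |p.2.1| ≤ 1 := by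
      rw [h3, abs_mul]
      nlinarith [abs_nonneg p.1, abs_nonneg p.2.2]
    refine ⟨?_, ?_, ?_⟩ <;> simp only [boxWidth, boxHeight, if_true] <;> linarith
  · have hm0 : 0 ≤ max |p.1| |p.2.1| := le_max_of_le_left (abs_nonneg _)
    have hm1 : max |p.1| |p.2.1| ≤ 1 / 2 := max_le h1 h2
    have hxy : |p.1 * p.2.1| ≤ 1 / 4 := by
      rw [abs_mul]
      nlinarith [abs_nonneg p.1, abs_nonneg p.2.1]
    obtain ⟨ha, hb⟩ := abs_le.mp hxy
    have hz : |p.2.2| ≤ 5 := by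
      rw [h3, abs_le]
      constructor <;> nlinarith
    refine ⟨?_, ?_, ?_⟩ <;> simp only [boxWidth, boxHeight, if_true] <;> linarith
  · have hx : |p.1| ≤ 1 := by
      rw [h3, abs_mul]
      nlinarith [abs_nonneg p.2.1, abs_nonneg p.2.2]
    refine ⟨?_, ?_, ?_⟩ <;> simp only [boxWidth, boxHeight, if_true] <;> linarith

/-- The new crosscut has a standard neighbourhood. -/
theorem mem_replacement_iff {p : R3} (hp : p ∈ box false) :
    p ∈ replacement ↔ p ∈ band false := by
  obtain ⟨b1, b2, b3⟩ := hp
  simp only [boxWidth, boxHeight, Bool.false_eq_true, if_false] at b1 b2 b3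
  simp only [band, boxWidth, Bool.false_eq_true, if_false]
  constructor
  · rintro ((⟨-, h4⟩ | ⟨h1, h2, h3⟩) | ⟨h1, h2, h3⟩)
    · exfalso; linarith
    · exfalso
      have hm1 : max |p.1| |p.2.1| ≤ 1 / 8 := max_le b1 b2
      have hxy : |p.1 * p.2.1| ≤ 1 / 64 := by
        rw [abs_mul]
        nlinarith [abs_nonneg p.1, abs_nonneg p.2.1]
      have := (abs_le.mp hxy).2
      have := (abs_le.mp b3).1
      nlinarith
    · exact ⟨b2, h2, h3⟩
  · rintro ⟨h1, h2, h3⟩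
    exact Or.inr ⟨by linarith, h2, h3⟩

/-! ### Surfaces with crosscuts and dots -/

/-- A subset of the 3-sphere with `k` ordered, directed crosscuts, labelled active (`true`) or
inactive (`false`), and finitely many dots off the link `L`.  Each crosscut comes with a standard
neighbourhood: an orientation-preserving tame embedding of the model box (the restriction of a
homeomorphism isotopic to the identity) in which the subset is the model band and the crosscut is
the vertical segment, directed upwards.  That the subset is a surface with boundary `L` is part
of `IsDkSurface`. -/
structure CrosscutSurface (L : Set S3) (k : ℕ) where
  carrier : Set S3
  active : Fin k → Bool
  frame : Fin k → (S3 ≃ₜ S3)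
  dots : Set S3
  frame_isotopic : ∀ i, IsotopicToId ∅ (frame i)
  frame_mem_iff : ∀ i, ∀ p ∈ box (active i), frame i (p : S3) ∈ carrier ↔ p ∈ band (active i)
  disjoint_nbhds : ∀ i j, i ≠ j →
    Disjoint (place (frame i) (box (active i))) (place (frame j) (box (active j)))
  dots_finite : dots.Finite
  dots_subset : dots ⊆ carrier \ (L ∪ ⋃ i, place (frame i) (box (active i)))

namespace CrosscutSurface

variable {L : Set S3} {k : ℕ}

/-- The standard neighbourhood of the `i`-th crosscut. -/
def nbhd (S : CrosscutSurface L k) (i : Fin k) : Set S3 := place (S.frame i) (box (S.active i))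

/-- Ambient isotopy of surfaces with crosscuts and dots, through surfaces with boundary `L`.
It carries the crosscuts with their order, directions and labels to each other.  A standard
neighbourhood may be carried to the other one with its two sides exchanged. -/
def Isotopic (S T : CrosscutSurface L k) : Prop :=
  ∃ h : S3 ≃ₜ S3, IsotopicToId L h ∧ h '' S.carrier = T.carrier ∧ h '' S.dots = T.dots ∧
    S.active = T.active ∧
    ∀ i, (∀ p ∈ box (S.active i), T.frame i (p : S3) = h (S.frame i (p : S3))) ∨
      (∀ p ∈ box (S.active i), T.frame i (p : S3) = h (S.frame i (halfTurn p : S3)))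

theorem Isotopic.refl (S : CrosscutSurface L k) : S.Isotopic S :=
  ⟨Homeomorph.refl S3, IsotopicToId.refl L, by simp, by simp, rfl, fun _ => Or.inl fun _ _ => rfl⟩

theorem Isotopic.symm {S T : CrosscutSurface L k} (hST : S.Isotopic T) : T.Isotopic S := by
  obtain ⟨h, hh, hc, hd, ha, hf⟩ := hST
  refine ⟨h.symm, hh.symm, ?_, ?_, ha.symm, fun i => ?_⟩
  · rw [← hc, ← Set.image_comp]; simp
  · rw [← hd, ← Set.image_comp]; simp
  · rw [← ha]
    rcases hf i with hi | hi
    · exact Or.inl fun p hp => by rw [hi p hp]; simp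
    · refine Or.inr fun p hp => ?_
      rw [hi _ (halfTurn_mem_box hp), halfTurn_halfTurn]; simp

theorem Isotopic.trans {S T U : CrosscutSurface L k} (hST : S.Isotopic T) (hTU : T.Isotopic U) :
    S.Isotopic U := by
  obtain ⟨h, hh, hc, hd, ha, hf⟩ := hST
  obtain ⟨g, gh, gc, gd, ga, gf⟩ := hTU
  refine ⟨h.trans g, hh.trans gh, ?_, ?_, ha.trans ga, fun i => ?_⟩
  · rw [← gc, ← hc, ← Set.image_comp]; rfl
  · rw [← gd, ← hd, ← Set.image_comp]; rfl
  · have gfi := gf i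
    rw [← ha] at gfi
    rcases hf i with hi | hi <;> rcases gfi with gi | gi
    · exact Or.inl fun p hp => by rw [gi p hp, hi p hp]; rfl
    · exact Or.inr fun p hp => by rw [gi p hp, hi _ (halfTurn_mem_box hp)]; rfl
    · exact Or.inr fun p hp => by rw [gi p hp, hi p hp]; rfl
    · refine Or.inl fun p hp => ?_
      rw [gi p hp, hi _ (halfTurn_mem_box hp), halfTurn_halfTurn]; rfl

/-! ### The cross-dual and `D^k`-surfaces -/

/-- The scale of the cut made at a crosscut in forming the cross-dual. -/
def cutWidth (a : Bool) : ℝ := boxWidth a / 2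

/-- The (locally oriented) piece of the cross-dual inserted at a crosscut.  The model band turns
in the left-handed sense at an active crosscut and in the right-handed sense at an inactive one;
cutting it open around the crosscut and inserting a right-handed, respectively left-handed, half
twist gives this untwisted strip.  Its local orientation is the one that is counterclockwise as
seen from above, the direction in which the crosscut points. -/
def strip (a : Bool) : Set R3 :=
  {p | |p.1| ≤ cutWidth a ∧ |p.2.1| ≤ cutWidth a ∧ p.2.2 = p.1 * p.2.1 / cutWidth a ^ 2}

/-- The part of the cross-dual in the model neighbourhood of a crosscut. -/
def crossDualPiece (a : Bool) : Set R3 :=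
  {p | p ∈ band a ∧ cutWidth a ≤ (if a then |p.1| else |p.2.1|)} ∪ strip a

/-- The cross-dual. -/
def crossDual (S : CrosscutSurface L k) : Set S3 :=
  (S.carrier \ ⋃ i, S.nbhd i) ∪ ⋃ i, place (S.frame i) (crossDualPiece (S.active i))

/-- The skeleton of the cross-dual: its boundary together with the inserted pieces. -/
def skeleton (S : CrosscutSurface L k) : Set S3 :=
  surfaceBoundary S.crossDual ∪ ⋃ i, place (S.frame i) (strip (S.active i))

/-- The standard lower half `z ≤ 0` of the 3-sphere, a closed ball. -/
def lowerBall : Set S3 := insert OnePoint.infty ((fun p : R3 => (p : S3)) '' {p | p.2.2 ≤ 0})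

/-- The standard upper half `0 ≤ z` of the 3-sphere, a closed ball. -/
def upperBall : Set S3 := insert OnePoint.infty ((fun p : R3 => (p : S3)) '' {p | 0 ≤ p.2.2})

/-- `D^k`-surfaces with boundary `L`.  The homeomorphism `g` exhibits the 3-sphere as the union
of two (tame) closed balls `B₊` and `B₋` that meet in their common boundary sphere `Σ`, which is
oriented as seen from `B₋`; the last condition says that the local orientation of each inserted
piece of the cross-dual, which lies in `Σ`, agrees with this orientation. -/
def IsDkSurface (S : CrosscutSurface L k) : Prop :=
  IsCompactSurface S.carrier ∧ surfaceBoundary S.carrier = L ∧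
  IsOrientableSurface S.crossDual ∧
  ∃ (g : S3 ≃ₜ S3) (Bplus Bminus Sphere : Set S3),
    Bplus = g '' lowerBall ∧ Bminus = g '' upperBall ∧ Sphere = Bplus ∩ Bminus ∧
    S.skeleton ⊆ Sphere ∧ S.crossDual \ S.skeleton ⊆ Bplus ∧
    ∀ i, ∀ᶠ p : R3 in 𝓝 (0, 0, 0),
      p.1 * p.2.1 / cutWidth (S.active i) ^ 2 < p.2.2 → S.frame i (p : S3) ∈ Bminus

/-! ### The local maps -/

theorem place_subset (h : S3 ≃ₜ S3) {A B : Set R3} (hAB : A ⊆ B) : place h A ⊆ place h B :=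
  Set.image_mono hAB

theorem mem_place (h : S3 ≃ₜ S3) {A : Set R3} {p : R3} : h (p : S3) ∈ place h A ↔ p ∈ A := by
  constructor
  · rintro ⟨q, hq, e⟩
    have : q = p := OnePoint.coe_injective (h.injective e)
    exact this ▸ hq
  · exact fun hp => ⟨p, hp, rfl⟩

theorem place_box_update (S : CrosscutSurface L k) {i : Fin k} (hi : S.active i = true)
    (j : Fin k) :
    place (S.frame j) (box (Function.update S.active i false j)) ⊆ S.nbhd j := by
  apply place_subset
  by_cases hj : j = i
  · subst hj
    rw [Function.update_self, hi]
    exact box_false_subset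
  · rw [Function.update_of_ne hj]

/-- The local map at an active crosscut `c`: the band around `c` is replaced by the piece of
surface `replacement`, on which `c` is an inactive crosscut.  Everything else stays. -/
def replaceAt (S : CrosscutSurface L k) (i : Fin k) (hi : S.active i = true) :
    CrosscutSurface L k where
  carrier := (S.carrier \ S.nbhd i) ∪ place (S.frame i) replacement
  active := Function.update S.active i false
  frame := S.frame
  dots := S.dots
  frame_isotopic := S.frame_isotopic
  frame_mem_iff := by
    intro j p hp
    by_cases hj : j = i
    · subst hj
      rw [Function.update_self] at hp ⊢
      have hb : S.frame j (p : S3) ∈ S.nbhd j := by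
        rw [nbhd, mem_place, hi]
        exact box_false_subset hp
      rw [← mem_replacement_iff hp, Set.mem_union, mem_place]
      exact ⟨fun h => h.elim (fun h => absurd hb h.2) id, Or.inr⟩
    · rw [Function.update_of_ne hj] at hp ⊢
      have hb : S.frame j (p : S3) ∉ S.nbhd i := fun h =>
        Set.disjoint_left.mp (S.disjoint_nbhds i j (Ne.symm hj)) h ((mem_place _).mpr hp)
      rw [← S.frame_mem_iff j p hp]
      constructor
      · rintro (h | h)
        · exact h.1
        · refine absurd (place_subset _ replacement_subset h) ?_
          rw [nbhd, hi] at hb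
          exact hb
      · exact fun h => Or.inl ⟨h, hb⟩
  disjoint_nbhds := fun j l hjl =>
    (S.disjoint_nbhds j l hjl).mono (S.place_box_update hi j) (S.place_box_update hi l)
  dots_finite := S.dots_finite
  dots_subset := by
    intro x hx
    obtain ⟨h1, h2⟩ := S.dots_subset hx
    refine ⟨Or.inl ⟨h1, fun h => h2 (Or.inr (Set.mem_iUnion.mpr ⟨i, h⟩))⟩, ?_⟩
    rintro (h | h)
    · exact h2 (Or.inl h)
    · obtain ⟨j, hj⟩ := Set.mem_iUnion.mp h
      exact h2 (Or.inr (Set.mem_iUnion.mpr ⟨j, S.place_box_update hi j hj⟩))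

theorem image_place {h f g : S3 ≃ₜ S3} {A : Set R3} (hA : A ⊆ box true)
    (hA' : ∀ p ∈ A, halfTurn p ∈ A)
    (hf : (∀ p ∈ box true, g (p : S3) = h (f (p : S3))) ∨
      (∀ p ∈ box true, g (p : S3) = h (f (halfTurn p : S3)))) :
    h '' place f A = place g A := by
  ext x
  constructor
  · rintro ⟨_, ⟨p, hp, rfl⟩, rfl⟩
    rcases hf with hf | hf
    · exact ⟨p, hp, hf p (hA hp)⟩
    · refine ⟨halfTurn p, hA' p hp, ?_⟩
      simp only [hf _ (hA (hA' p hp)), halfTurn_halfTurn]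
  · rintro ⟨p, hp, rfl⟩
    rcases hf with hf | hf
    · exact ⟨_, ⟨p, hp, rfl⟩, (hf p (hA hp)).symm⟩
    · exact ⟨_, ⟨_, hA' p hp, rfl⟩, (hf p (hA hp)).symm⟩

theorem Isotopic.replaceAt {S T : CrosscutSurface L k} (hST : S.Isotopic T) (i : Fin k)
    (hi : S.active i = true) (hi' : T.active i = true) :
    (S.replaceAt i hi).Isotopic (T.replaceAt i hi') := by
  obtain ⟨h, hh, hc, hd, ha, hf⟩ := hST
  have hfi := hf i
  rw [hi] at hfi
  refine ⟨h, hh, ?_, hd, ?_, fun j => ?_⟩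
  · change h '' ((S.carrier \ S.nbhd i) ∪ _) = (T.carrier \ T.nbhd i) ∪ _
    rw [Set.image_union, Set.image_sdiff h.injective, hc,
      image_place replacement_subset (fun _ => halfTurn_mem_replacement) hfi, nbhd, nbhd, hi, hi',
      image_place subset_rfl (fun _ => halfTurn_mem_box) hfi]
  · change Function.update S.active i false = Function.update T.active i false
    rw [ha]
  · have hb : box (Function.update S.active i false j) ⊆ box (S.active j) := by
      by_cases hj : j = i
      · subst hj
        rw [Function.update_self, hi]
        exact box_false_subset
      · rw [Function.update_of_ne hj]
    exact (hf j).imp (fun H p hp => H p (hb hp)) (fun H p hp => H p (hb hp))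

instance setoid (L : Set S3) (k : ℕ) : Setoid (CrosscutSurface L k) where
  r := Isotopic
  iseqv := ⟨Isotopic.refl, Isotopic.symm, Isotopic.trans⟩

end CrosscutSurface

/-! ### Chain modules and the differential -/

/-- Isotopy classes of surfaces with `k` crosscuts. -/
abbrev IsotopyClass (L : Set S3) (k : ℕ) : Type := Quotient (CrosscutSurface.setoid L k)

/-- The labels of the crosscuts of an isotopy class. -/
def IsotopyClass.active {L : Set S3} {k : ℕ} (q : IsotopyClass L k) : Fin k → Bool :=
  Quotient.lift CrosscutSurface.active (fun _ _ h => by obtain ⟨_, _, _, _, ha, _⟩ := h; exact ha) q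

/-- The number of inactive crosscuts that come before the `i`-th crosscut. -/
def IsotopyClass.alpha {L : Set S3} {k : ℕ} (q : IsotopyClass L k) (i : Fin k) : ℕ :=
  (Finset.univ.filter fun j : Fin k => j < i ∧ q.active j = false).card

variable (R : Type*) [CommRing R] (L : Set S3) (k : ℕ)

/-- The free module on the isotopy classes of surfaces with `k` crosscuts. -/
abbrev SurfaceModule : Type _ := IsotopyClass L k →₀ R

/-- The chain module of `L` with `k` crosscuts: the free module on the isotopy classes of
`D^k`-surfaces with boundary `L`. -/
def chainModule : Submodule R (SurfaceModule R L k) :=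
  Finsupp.supported R R
    {q | ∃ S : CrosscutSurface L k, S.IsDkSurface ∧ (⟦S⟧ : IsotopyClass L k) = q}

/-- The local map at the `i`-th crosscut, on the isotopy class of a surface; it is zero if that
crosscut is inactive. -/
def localMapClass (i : Fin k) : IsotopyClass L k → SurfaceModule R L k :=
  Quotient.lift
    (fun S => if hi : S.active i = true then Finsupp.single ⟦S.replaceAt i hi⟧ 1 else 0)
    (fun S T hST => by
      have ha : S.active = T.active := by obtain ⟨_, _, _, _, ha, _⟩ := hST; exact ha
      by_cases hi : S.active i = true
      · have hi' : T.active i = true := ha ▸ hi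
        rw [dif_pos hi, dif_pos hi']
        congr 1
        exact Quotient.sound (CrosscutSurface.Isotopic.replaceAt hST i hi hi')
      · have hi' : ¬ T.active i = true := ha ▸ hi
        rw [dif_neg hi, dif_neg hi'])

/-- The linear extension of the local map at the `i`-th crosscut. -/
def localMap (i : Fin k) : SurfaceModule R L k →ₗ[R] SurfaceModule R L k :=
  Finsupp.linearCombination R (localMapClass R L k i)

/-- The differential: on a generator `F`, the sum over the active crosscuts `c` of `F` of
`(-1) ^ α(c)` times the image of `F` under the local map at `c`. -/
def differential : SurfaceModule R L k →ₗ[R] SurfaceModule R L k :=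
  Finsupp.linearCombination R fun q : IsotopyClass L k =>
    ∑ i ∈ Finset.univ.filter (fun i : Fin k => q.active i = true),
      (-1 : R) ^ q.alpha i • localMapClass R L k i q

end Diagramless

end

namespace Diagramless

/-! ### Replacements at two distinct crosscuts -/

namespace CrosscutSurface

variable {L : Set S3} {k : ℕ}

/-! The local map at a crosscut changes the surface only inside the standard neighbourhood of that
crosscut, and these neighbourhoods are pairwise disjoint. So two replacements at distinct crosscuts,
made in either order, give literally the same subset with the same decorations
(`carrier_replaceAt_replaceAt`, `CrosscutSurface.replaceAt_comm`), and the local maps commute.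

For the square of the differential, expand it as a sum over ordered pairs of crosscuts. A diagonal
pair contributes zero, since a replaced crosscut is inactive (`localMap_localMapClass_self`). For `i
< j`, acting at `i` first adds one inactive crosscut before `j`, whereas acting at `j` first leaves
the count before `i` unchanged. Hence the two orders carry opposite signs (`squareSign_swap`), and
by commutation they cancel.

Everything is computed on generators of the ambient module `SurfaceModule`, where composites of
these maps make sense without knowing that they preserve `chainModule`. -/

theorem active_replaceAt_of_ne (S : CrosscutSurface L k) {i j : Fin k} (hij : j ≠ i)
    (hi : S.active i = true) : (S.replaceAt i hi).active j = S.active j :=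
  Function.update_of_ne hij _ _

theorem active_replaceAt_self (S : CrosscutSurface L k) {i : Fin k} (hi : S.active i = true) :
    (S.replaceAt i hi).active i = false :=
  Function.update_self _ _ _

theorem nbhd_replaceAt_of_ne (S : CrosscutSurface L k) {i j : Fin k} (hij : j ≠ i)
    (hi : S.active i = true) : (S.replaceAt i hi).nbhd j = S.nbhd j := by
  rw [nbhd, active_replaceAt_of_ne S hij hi]
  rfl

theorem place_replacement_subset_nbhd (S : CrosscutSurface L k) {i : Fin k}
    (hi : S.active i = true) : place (S.frame i) replacement ⊆ S.nbhd i := by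
  rw [nbhd, hi]
  exact place_subset _ replacement_subset

/-- The point of this form is that the right-hand side is symmetric in `i` and `j`. -/
theorem carrier_replaceAt_replaceAt (S : CrosscutSurface L k) {i j : Fin k} (hij : i ≠ j)
    (hi : S.active i = true) (hj : (S.replaceAt i hi).active j = true) :
    ((S.replaceAt i hi).replaceAt j hj).carrier =
      (S.carrier \ (S.nbhd i ∪ S.nbhd j)) ∪
        (place (S.frame i) replacement ∪ place (S.frame j) replacement) := by
  -- The piece glued in at `i` stays inside the neighbourhood of `i`, so it survives the removal of
  -- the neighbourhood of `j`.
  have hd : Disjoint (place (S.frame i) replacement) (S.nbhd j) :=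
    (S.disjoint_nbhds i j hij).mono_left (S.place_replacement_subset_nbhd hi)
  change (((S.carrier \ S.nbhd i) ∪ place (S.frame i) replacement) \ (S.replaceAt i hi).nbhd j) ∪
    place (S.frame j) replacement = _
  rw [nbhd_replaceAt_of_ne S hij.symm hi, Set.union_sdiff_distrib, hd.sdiff_eq_left,
    Set.sdiff_sdiff, Set.union_assoc]

/-- Replacements at two distinct crosscuts commute. -/
theorem replaceAt_comm (S : CrosscutSurface L k) {i j : Fin k} (hij : i ≠ j)
    (hi : S.active i = true) (hj : S.active j = true)
    (hj' : (S.replaceAt i hi).active j = true) (hi' : (S.replaceAt j hj).active i = true) :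
    ((S.replaceAt i hi).replaceAt j hj').Isotopic ((S.replaceAt j hj).replaceAt i hi') := by
  -- Carriers, labels, frames and dots all coincide, so the constant isotopy suffices.
  refine ⟨Homeomorph.refl S3, IsotopicToId.refl L, ?_, Set.image_id _, ?_,
    fun _ => Or.inl fun _ _ => rfl⟩
  · rw [carrier_replaceAt_replaceAt S hij hi hj', carrier_replaceAt_replaceAt S hij.symm hj hi',
      Set.union_comm (S.nbhd i), Set.union_comm (place (S.frame i) replacement)]
    exact Set.image_id _
  · exact Function.update_comm hij _ _ _

end CrosscutSurface

/-! ### Commutation of the local maps -/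

variable (R : Type*) [CommRing R] {L : Set S3} {k : ℕ}

theorem localMapClass_mk_of_active (S : CrosscutSurface L k) {i : Fin k}
    (hi : S.active i = true) :
    localMapClass R L k i ⟦S⟧ = Finsupp.single ⟦S.replaceAt i hi⟧ 1 :=
  dif_pos hi

theorem localMapClass_mk_of_inactive (S : CrosscutSurface L k) {i : Fin k}
    (hi : ¬ S.active i = true) : localMapClass R L k i ⟦S⟧ = 0 :=
  dif_neg hi

theorem localMap_single (i : Fin k) (q : IsotopyClass L k) :
    localMap R L k i (Finsupp.single q 1) = localMapClass R L k i q := by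
  simp [localMap]

/-- A replacement at `j` cannot reactivate another crosscut. This settles the cases of commutation
in which one of the two crosscuts is inactive. -/
theorem localMap_localMapClass_of_inactive (S : CrosscutSurface L k) {i j : Fin k} (hij : i ≠ j)
    (hi : ¬ S.active i = true) : localMap R L k i (localMapClass R L k j ⟦S⟧) = 0 := by
  by_cases hj : S.active j = true
  · rw [localMapClass_mk_of_active R S hj, localMap_single, localMapClass_mk_of_inactive]
    rwa [S.active_replaceAt_of_ne hij hj]
  · rw [localMapClass_mk_of_inactive R S hj, map_zero]

theorem localMap_localMapClass_self (i : Fin k) (q : IsotopyClass L k) :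
    localMap R L k i (localMapClass R L k i q) = 0 := by
  induction q using Quotient.inductionOn with | _ S
  by_cases hi : S.active i = true
  · rw [localMapClass_mk_of_active R S hi, localMap_single, localMapClass_mk_of_inactive]
    simp [S.active_replaceAt_self hi]
  · rw [localMapClass_mk_of_inactive R S hi, map_zero]

theorem localMap_localMapClass_comm {i j : Fin k} (hij : i ≠ j) (q : IsotopyClass L k) :
    localMap R L k i (localMapClass R L k j q) = localMap R L k j (localMapClass R L k i q) := by
  induction q using Quotient.inductionOn with | _ S
  by_cases hi : S.active i = true
  · by_cases hj : S.active j = true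
    · have hj' := (S.active_replaceAt_of_ne hij.symm hi).trans hj
      have hi' := (S.active_replaceAt_of_ne hij hj).trans hi
      rw [localMapClass_mk_of_active R S hi, localMapClass_mk_of_active R S hj,
        localMap_single, localMap_single, localMapClass_mk_of_active R _ hi',
        localMapClass_mk_of_active R _ hj',
        Quotient.sound (S.replaceAt_comm hij.symm hj hi hi' hj')]
    · rw [localMapClass_mk_of_inactive R S hj, map_zero,
        localMap_localMapClass_of_inactive R S hij.symm hj]
  · rw [localMapClass_mk_of_inactive R S hi, map_zero,
      localMap_localMapClass_of_inactive R S hij hi]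

/-- The local maps at distinct crosscuts commute. -/
theorem localMap_comm {i j : Fin k} (hij : i ≠ j) (x : SurfaceModule R L k) :
    localMap R L k i (localMap R L k j x) = localMap R L k j (localMap R L k i x) := by
  suffices h : localMap R L k i ∘ₗ localMap R L k j = localMap R L k j ∘ₗ localMap R L k i from
    LinearMap.congr_fun h x
  refine Finsupp.lhom_ext' fun q => LinearMap.ext_ring ?_
  simp only [LinearMap.comp_apply, Finsupp.lsingle_apply, localMap_single]
  exact localMap_localMapClass_comm R hij q

/-! ### Signs and the square of the differential -/

/-- The crosscut `i` lies before `j` and has just become inactive, so it is the one new element of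
the set counted by `alpha`. -/
theorem alpha_replaceAt_of_lt (S : CrosscutSurface L k) {i j : Fin k} (hij : i < j)
    (hi : S.active i = true) :
    IsotopyClass.alpha (⟦S.replaceAt i hi⟧ : IsotopyClass L k) j =
      IsotopyClass.alpha (⟦S⟧ : IsotopyClass L k) j + 1 := by
  have hmem : i ∉ Finset.univ.filter fun l : Fin k => l < j ∧ S.active l = false := by simp [hi]
  change (Finset.univ.filter fun l : Fin k => l < j ∧ (S.replaceAt i hi).active l = false).card =
    (Finset.univ.filter fun l : Fin k => l < j ∧ S.active l = false).card + 1
  rw [← Finset.card_insert_of_notMem hmem]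
  congr 1
  ext l
  by_cases hl : l = i
  · subst hl
    simp [hij, S.active_replaceAt_self hi]
  · simp [hl, S.active_replaceAt_of_ne hl hi]

/-- Only crosscuts strictly before `j` are counted, and `i` is not among them, even when `i = j`. -/
theorem alpha_replaceAt_of_le (S : CrosscutSurface L k) {i j : Fin k} (hij : j ≤ i)
    (hi : S.active i = true) :
    IsotopyClass.alpha (⟦S.replaceAt i hi⟧ : IsotopyClass L k) j =
      IsotopyClass.alpha (⟦S⟧ : IsotopyClass L k) j := by
  change (Finset.univ.filter fun l : Fin k => l < j ∧ (S.replaceAt i hi).active l = false).card =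
    (Finset.univ.filter fun l : Fin k => l < j ∧ S.active l = false).card
  congr 1
  ext l
  simp only [Finset.mem_filter, Finset.mem_univ, true_and, and_congr_right_iff]
  intro hl
  rw [S.active_replaceAt_of_ne (hl.trans_le hij).ne hi]

/-- Inactive crosscuts may be added to the sum because their local maps vanish. The index set then
no longer depends on `q`, so the double sum for the square runs over all pairs. -/
theorem differential_single (q : IsotopyClass L k) :
    differential R L k (Finsupp.single q 1) =
      ∑ i : Fin k, (-1 : R) ^ q.alpha i • localMapClass R L k i q := by
  rw [differential, Finsupp.linearCombination_single, one_smul]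
  refine Finset.sum_filter_of_ne fun i _ hne => ?_
  induction q using Quotient.inductionOn with | _ S
  by_contra hi
  exact hne (by rw [localMapClass_mk_of_inactive R S hi, smul_zero])

/-- The sign with which the composite of the local maps at `i` and then `j` occurs in the square
of the differential. -/
def squareSign (q : IsotopyClass L k) (i j : Fin k) : R :=
  (-1) ^ q.alpha i * (-1) ^ (q.alpha j + if i < j then 1 else 0)

/-- The extra exponent is present for exactly one of the two orders of distinct indices. -/
theorem squareSign_swap (q : IsotopyClass L k) {i j : Fin k} (hij : i ≠ j) :
    squareSign R q i j = - squareSign R q j i := by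
  rcases hij.lt_or_gt with h | h
  · simp [squareSign, h, h.not_gt, pow_succ, mul_comm]
  · simp [squareSign, h, h.not_gt, pow_succ, mul_comm]

/-- The sign of the second step is that of the surface already modified at `i`; it is rewritten
through the labels of the original `q`, so that the two orders can be compared. -/
theorem differential_localMapClass (q : IsotopyClass L k) (i : Fin k) :
    (-1 : R) ^ q.alpha i • differential R L k (localMapClass R L k i q) =
      ∑ j : Fin k, squareSign R q i j • localMap R L k j (localMapClass R L k i q) := by
  induction q using Quotient.inductionOn with | _ S
  by_cases hi : S.active i = true
  · rw [localMapClass_mk_of_active R S hi, differential_single, Finset.smul_sum]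
    refine Finset.sum_congr rfl fun j _ => ?_
    rw [localMap_single, smul_smul, squareSign]
    by_cases hij : i < j
    · rw [alpha_replaceAt_of_lt S hij hi, if_pos hij]
    · rw [alpha_replaceAt_of_le S (not_lt.mp hij) hi, if_neg hij, add_zero]
  · simp [localMapClass_mk_of_inactive R S hi]

theorem differential_differential_single (q : IsotopyClass L k) :
    differential R L k (differential R L k (Finsupp.single q 1)) = 0 := by
  rw [differential_single, map_sum]
  simp only [map_smul, differential_localMapClass]
  rw [← Finset.sum_product']
  -- Swapping the pair is the cancelling involution. Its fixed points are the diagonal pairs, whose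
  -- terms have to vanish on their own.
  refine Finset.sum_involution (fun p _ => p.swap) ?_ ?_ (fun _ _ => by simp) (fun _ _ => by simp)
  · rintro ⟨i, j⟩ -
    rcases eq_or_ne i j with rfl | hij
    · simp [localMap_localMapClass_self]
    · simp only [Prod.swap_prod_mk]
      rw [squareSign_swap R q hij, localMap_localMapClass_comm R hij, neg_smul, neg_add_cancel]
  · rintro ⟨i, j⟩ - hne heq
    obtain rfl : j = i := congrArg Prod.fst heq
    exact hne (by simp [localMap_localMapClass_self])

/-- The differential squares to zero. -/
theorem differential_differential (x : SurfaceModule R L k) :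
    differential R L k (differential R L k x) = 0 := by
  suffices h : differential R L k ∘ₗ differential R L k = 0 from LinearMap.congr_fun h x
  refine Finsupp.lhom_ext' fun q => LinearMap.ext_ring ?_
  simpa using differential_differential_single R q

end Diagramless

theorem mainTheorem7 (R : Type*) [CommRing R] (L : Set Diagramless.S3) (k : ℕ) :
    (∀ i j : Fin k, i ≠ j → ∀ x ∈ Diagramless.chainModule R L k,
      Diagramless.localMap R L k i (Diagramless.localMap R L k j x) =
        Diagramless.localMap R L k j (Diagramless.localMap R L k i x)) ∧
    (∀ x ∈ Diagramless.chainModule R L k,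
      Diagramless.differential R L k (Diagramless.differential R L k x) = 0) := by
  exact ⟨fun _ _ hij x _ => Diagramless.localMap_comm R hij x,
    fun x _ => Diagramless.differential_differential R x⟩
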